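/- Theorem 4.4. Let $d>2$ be an integer, let $P\subset[0,\infty)^d$ be a convex body (compact, convex, with nonempty interior) with $0\in P$, and let $f:P\to(0,\infty)$ be continuous. Let $(c_{\alpha,n})$, $\alpha\in\mathbb{Z}_+^d=\{0,1,2,\dots\}^d$, $n\in\mathbb{N}$, be complex numbers such that $$\lim_{n\to\infty}\ \sup_{\alpha\in nP\cap\mathbb{Z}_+^d}\Big|\frac1n\log|c_{\alpha,n}|-\log f(\alpha/n)\Big|=0 ,$$ where $nP=\{nt:t\in P\}$ and $\log 0=-\infty$. Let $(\xi_\alpha)_{\alpha\in\mathbb{Z}_+^d}$ be independent, identically distributed complex-valued random variables on a probability space, not almost surely constant, with $$\mathbb{E}\big[(\log(1+|\xi_0|))^d\big]<\infty .$$ Put $$\mathbf{P}_n(z)=\sum_{\alpha\in nP\cap\mathbb{Z}_+^d}\xi_\alpha\,c_{\alpha,n}\,z_1^{\alpha_1}\cdots z_d^{\alpha_d},\qquad z\in\mathbb{C}^d,$$ and, for $z\in(\mathbb{C}^*)^d$, where $\mathbb{C}^*=\mathbb{C}\setminus\{0\}$, $$\Phi_{P,f}(z)=\sup_{t\in P}\Big(\sum_{j=1}^d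 t_j\log|z_j|+\log f(t)\Big).$$ Then for every fixed $z\in(\mathbb{C}^*)^d$, almost surely, $\mathbf{P}_n(z)\neq0$ for all sufficiently large $n$ and $$\frac1n\log|\mathbf{P}_n(z)|\longrightarrow\Phi_{P,f}(z)\qquad\text{as } n\to\infty .$$ -/

import Mathlib

open MeasureTheory ProbabilityTheory Filter Topology
open scoped Pointwise

namespace PPoly

/-- The lattice set `nP ∩ ℤ₊^d`, as a set of multi-indices. -/
def latticeSet {d : ℕ} (P : Set (Fin d → ℝ)) (n : ℕ) : Set (Fin d → ℕ) :=
  {α | (fun j => (α j : ℝ)) ∈ (n : ℝ) • P}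

/-- For bounded `P` the lattice set is finite, so the sum defining `randPoly` below is a genuine
finite sum. -/
theorem latticeSet_finite {d : ℕ} {P : Set (Fin d → ℝ)} (hP : Bornology.IsBounded P) (n : ℕ) :
    (latticeSet P n).Finite := by
  obtain ⟨R, hR⟩ := (hP.smul₀ (n : ℝ)).exists_norm_le
  refine (Set.finite_Iic (fun _ : Fin d => ⌊R⌋₊)).subset fun α hα j => ?_
  have h1 := (norm_le_pi_norm (fun j => (α j : ℝ)) j).trans (hR _ hα)
  rw [Real.norm_of_nonneg (Nat.cast_nonneg _)] at h1
  exact Nat.le_floor h1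

/-- The random polynomial
`𝐏ₙ(z, ω) = ∑_{α ∈ nP ∩ ℤ₊^d} ξ_α(ω) c_{α,n} z₁^{α₁} ⋯ z_d^{α_d}`. -/
noncomputable def randPoly {d : ℕ} {Ω : Type*} (P : Set (Fin d → ℝ))
    (ξ : (Fin d → ℕ) → Ω → ℂ) (c : (Fin d → ℕ) → ℕ → ℂ) (n : ℕ) (z : Fin d → ℂ) (ω : Ω) : ℂ :=
  ∑ᶠ α ∈ latticeSet P n, ξ α ω * c α n * ∏ j, z j ^ α j

/-- The array `c` has uniform exponential profile `f` on `P`: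
`sup_{α ∈ nP ∩ ℤ₊^d} |(1/n) log|c_{α,n}| - log f(α/n)| → 0` as `n → ∞`.
With `log 0 = -∞` the supremum is infinite as soon as some `c_{α,n}` vanishes; since `Real.log 0 = 0`,
this is recorded by the explicit requirement `c α n ≠ 0`. -/
def HasProfile {d : ℕ} (P : Set (Fin d → ℝ)) (f : (Fin d → ℝ) → ℝ)
    (c : (Fin d → ℕ) → ℕ → ℂ) : Prop :=
  ∀ ε : ℝ, 0 < ε → ∀ᶠ n : ℕ in atTop, ∀ α ∈ latticeSet P n,
    c α n ≠ 0 ∧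
      |(1 / (n : ℝ)) * Real.log ‖c α n‖ - Real.log (f fun j => (α j : ℝ) / (n : ℝ))| ≤ ε

/-- The restricted Legendre–Fenchel transform `I_{P,f}(s) = sup_{t ∈ P} (⟨s, t⟩ + log f(t))`. -/
noncomputable def legendre {d : ℕ} (P : Set (Fin d → ℝ)) (f : (Fin d → ℝ) → ℝ)
    (s : Fin d → ℝ) : ℝ :=
  sSup ((fun t : Fin d → ℝ => (∑ j, s j * t j) + Real.log (f t)) '' P)

/-- The potential `Φ_{P,f}(z) = I_{P,f}(log|z₁|, …, log|z_d|)` at a point `z` of the complex torus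
`(ℂ \ {0})^d`. -/
noncomputable def potential {d : ℕ} (P : Set (Fin d → ℝ)) (f : (Fin d → ℝ) → ℝ)
    (z : Fin d → ℂ) : ℝ :=
  legendre P f fun j => Real.log ‖z j‖

end PPoly

/-! ### Littlewood–Offord counting -/

namespace PPoly

/-! At a fixed `z` the polynomial is a sum of i.i.d. variables with weights of size `exp(n(g(α/n) +
o(1)))`, uniformly in `α`, where `g(t) = ∑ t_j log|z_j| + log f(t)` has maximum `Φ` on `P`. It
suffices to trap `|𝐏ₙ(z)|` between `exp(n(Φ ± η))` almost surely for large `n`.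

Upper bound: the `d`-th log-moment makes the expected number of `α ∈ ℕ^d` with `log(1+|ξ_α|) ≥ ε max
α_j` finite, so the coefficients grow subexponentially, and there are only polynomially many terms
(`ae_eventually_norm_randPoly_le`).

Lower bound: cancellation must be excluded. `g` stays near its maximum on a box in `P`, so order
`n^d` weights far exceed `exp(n(Φ-η))`. A Kolmogorov–Rogozin inequality (`pi_real_norm_sum_le`)
bounds the probability of a smaller sum by `O(n^{-d/2})`, summable as `d > 2`, and Borel–Cantelli
applies. The inequality comes from symmetrization: given independent pairs, picking one entry of
each pair at random leads to Erdős's Littlewood–Offord count, settled by Sperner's theorem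
(`card_abs_add_sum_le`). -/

theorem centralBinom_sq_mul_le (k : ℕ) : k.centralBinom ^ 2 * (2 * k + 1) ≤ 4 ^ (2 * k) := by
  induction k with
  | zero => simp
  | succ k ih =>
    have h := Nat.succ_mul_centralBinom_succ k
    refine Nat.le_of_mul_le_mul_left (c := (k + 1) ^ 2) ?_ (by positivity)
    calc (k + 1) ^ 2 * ((k + 1).centralBinom ^ 2 * (2 * (k + 1) + 1))
        = ((k + 1) * (k + 1).centralBinom) ^ 2 * (2 * k + 3) := by ring
      _ = (k.centralBinom ^ 2 * (2 * k + 1)) * (4 * ((2 * k + 1) * (2 * k + 3))) := by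
          rw [h]; ring
      -- The induction closes because `(2k+1)(2k+3) = (2k+2)² - 1`.
      _ ≤ 4 ^ (2 * k) * (4 * (4 * (k + 1) ^ 2)) := by exact Nat.mul_le_mul ih (Nat.mul_le_mul_left 4 (by nlinarith))
      _ = (k + 1) ^ 2 * 4 ^ (2 * (k + 1)) := by ring

theorem choose_half_sq_mul_le (h : ℕ) : h.choose (h / 2) ^ 2 * (h + 1) ≤ 4 ^ h := by
  obtain ⟨k, rfl | rfl⟩ := h.even_or_odd'
  · simpa [Nat.centralBinom_eq_two_mul_choose] using centralBinom_sq_mul_le k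
  · have h1 : (2 * k + 1) / 2 = k := by omega
    have h2 : (k + 1).centralBinom = 2 * (2 * k + 1).choose k := by
      rw [Nat.centralBinom_eq_two_mul_choose, show 2 * (k + 1) = 2 * k + 1 + 1 by ring,
        Nat.choose_succ_succ, Nat.choose_symm_half]
      ring
    have h3 := centralBinom_sq_mul_le (k + 1)
    rw [h2] at h3
    rw [h1]
    refine Nat.le_of_mul_le_mul_left (c := 4) ?_ (by norm_num)
    calc 4 * ((2 * k + 1).choose k ^ 2 * (2 * k + 1 + 1))
        ≤ (2 * (2 * k + 1).choose k) ^ 2 * (2 * (k + 1) + 1) := by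
          rw [mul_pow, ← mul_assoc]; gcongr <;> omega
      _ ≤ 4 ^ (2 * (k + 1)) := h3
      _ = 4 * 4 ^ (2 * k + 1) := by ring

open Finset in
/-- The Littlewood–Offord bound of Erdős, for real weights. -/
theorem card_abs_add_sum_le {ι : Type*} [Fintype ι] [DecidableEq ι] (w : ι → ℝ) (b δ : ℝ)
    (H : Finset ι) (hH : ∀ i ∈ H, 2 * δ < |w i|) :
    #{σ : Finset ι | |b + ∑ i ∈ σ, w i| ≤ δ} ≤
      (#H).choose (#H / 2) * 2 ^ (Fintype.card ι - #H) := by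
  classical
  set S : Finset (Finset ι) := {σ : Finset ι | |b + ∑ i ∈ σ, w i| ≤ δ} with hS
  -- `g σ` marks where `σ` makes the larger of the two possible contributions. With `σ \ H` fixed,
  -- strictly enlarging `g σ` raises the sum by more than `2δ`, too much for the window `[-δ, δ]`,
  -- so the sets `g σ` form an antichain.
  let g : Finset ι → Finset H := fun σ => {i | i.1 ∈ σ ↔ 0 ≤ w i}
  have key : ∀ σ ∈ S, ∀ σ' ∈ S, σ \ H = σ' \ H → g σ ⊆ g σ' → σ = σ' := by
    intro σ hσ σ' hσ' hout hsub
    by_contra hne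
    have hnot : ∀ i ∉ H, (i ∈ σ ↔ i ∈ σ') := fun i hi => by
      simpa [hi] using congrArg (i ∈ ·) hout
    have hin : ∀ i ∈ H, (i ∈ σ ↔ 0 ≤ w i) → (i ∈ σ' ↔ 0 ≤ w i) := fun i hi h => by
      simpa [g] using hsub (show (⟨i, hi⟩ : H) ∈ g σ by simpa [g] using h)
    let D : ι → ℝ := fun i => (if i ∈ σ' then w i else 0) - (if i ∈ σ then w i else 0)
    have hD : ∑ i, D i = (b + ∑ i ∈ σ', w i) - (b + ∑ i ∈ σ, w i) := by
      simp [D, Finset.sum_sub_distrib]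
    have hD0 : ∀ i, 0 ≤ D i := by
      intro i
      by_cases hi : i ∈ H
      · have := hin i hi
        by_cases h1 : i ∈ σ <;> by_cases h2 : i ∈ σ' <;> by_cases h3 : 0 ≤ w i <;>
          simp_all [D, le_of_lt, not_le_of_gt]
      · simp [D, hnot i hi]
    obtain ⟨i, hi⟩ : ∃ i, ¬ (i ∈ σ ↔ i ∈ σ') := by
      by_contra! h
      exact hne (Finset.ext h)
    have hiH : i ∈ H := by
      by_contra h
      exact hi (hnot i h)
    have hDi : 2 * δ < D i := by
      have h1 := hin i hiH
      have h2 := hH i hiH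
      have h3 := hD0 i
      have h4 : |D i| = |w i| := by
        by_cases h1 : i ∈ σ <;> by_cases h2 : i ∈ σ' <;> simp_all [D]
      rwa [← h4, abs_of_nonneg h3] at h2
    have h5 := Finset.single_le_sum (fun i _ => hD0 i) (Finset.mem_univ i)
    have h6 := abs_le.1 (Finset.mem_filter.1 hσ).2
    have h7 := abs_le.1 (Finset.mem_filter.1 hσ').2
    linarith
  have himg : #(S.image (· \ H)) ≤ 2 ^ (Fintype.card ι - #H) := by
    rw [← Finset.card_compl, ← Finset.card_powerset]
    refine Finset.card_le_card fun τ hτ => ?_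
    obtain ⟨σ, -, rfl⟩ := Finset.mem_image.1 hτ
    rw [Finset.mem_powerset, Finset.sdiff_eq_inter_compl]
    exact Finset.inter_subset_right
  refine (Finset.card_le_mul_card_image (f := (· \ H)) S _ fun τ _ => ?_).trans
    (Nat.mul_le_mul_left _ himg)
  have hinj : Set.InjOn g ↑(S.filter fun σ => σ \ H = τ) := by
    intro σ hσ σ' hσ' h
    simp only [Finset.coe_filter, Set.mem_ofPred_eq] at hσ hσ'
    exact key σ hσ.1 σ' hσ'.1 (hσ.2.trans hσ'.2.symm) h.subset
  rw [← Finset.card_image_of_injOn hinj]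
  have hanti : IsAntichain (· ⊆ ·) (↑((S.filter fun σ => σ \ H = τ).image g) : Set (Finset H)) := by
    intro A hA B hB hne hsub
    simp only [Finset.coe_image, Finset.coe_filter, Set.mem_image, Set.mem_ofPred_eq] at hA hB
    obtain ⟨σ, hσ, rfl⟩ := hA
    obtain ⟨σ', hσ', rfl⟩ := hB
    exact hne (congrArg g (key σ hσ.1 σ' hσ'.1 (hσ.2.trans hσ'.2.symm) hsub))
  simpa using hanti.sperner

open Finset in
-- Squaring keeps the bound `C(h, h/2) ≤ 2^h / √(h+1)` within the natural numbers.
theorem card_abs_add_sum_sq_mul_le {ι : Type*} [Fintype ι] [DecidableEq ι] (w : ι → ℝ) (b δ : ℝ)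
    (H : Finset ι) (hH : ∀ i ∈ H, 2 * δ < |w i|) :
    #{σ : Finset ι | |b + ∑ i ∈ σ, w i| ≤ δ} ^ 2 * #H ≤ 4 ^ Fintype.card ι := by
  calc _ ≤ ((#H).choose (#H / 2) * 2 ^ (Fintype.card ι - #H)) ^ 2 * (#H + 1) := by
        gcongr
        · exact card_abs_add_sum_le w b δ H hH
        · omega
    _ = ((#H).choose (#H / 2) ^ 2 * (#H + 1)) * 4 ^ (Fintype.card ι - #H) := by
        rw [mul_pow, ← pow_mul, mul_comm _ 2, pow_mul 2 2]; norm_num; ring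
    _ ≤ 4 ^ #H * 4 ^ (Fintype.card ι - #H) := by
        gcongr
        exact choose_half_sq_mul_le _
    _ = 4 ^ Fintype.card ι := by
        rw [← pow_add, Nat.add_sub_cancel' (Finset.card_le_univ H)]

open Finset in
/-- The Littlewood–Offord bound for complex weights. -/
theorem card_norm_add_sum_sq_mul_le {ι : Type*} [Fintype ι] [DecidableEq ι] (v : ι → ℂ) (b : ℂ)
    {δ : ℝ} (G : Finset ι) (hG : ∀ i ∈ G, 4 * δ < ‖v i‖) :
    #{σ : Finset ι | ‖b + ∑ i ∈ σ, v i‖ ≤ δ} ^ 2 * #G ≤ 2 * 4 ^ Fintype.card ι := by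
  classical
  -- A modulus above `4δ` forces a real or an imaginary part above `2δ`; the real bound is applied
  -- to each class and the two are added.
  have hcover : G ⊆ G.filter (fun i => 2 * δ < |(v i).re|) ∪
      G.filter (fun i => 2 * δ < |(v i).im|) := by
    intro i hi
    have h1 := hG i hi
    have h2 := Complex.norm_le_abs_re_add_abs_im (v i)
    simp only [Finset.mem_union, Finset.mem_filter, hi, true_and]
    by_contra! h
    linarith
  have hre := card_abs_add_sum_sq_mul_le (fun i => (v i).re) b.re δ
    (G.filter (fun i => 2 * δ < |(v i).re|)) (by simp)
  have him := card_abs_add_sum_sq_mul_le (fun i => (v i).im) b.im δ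
    (G.filter (fun i => 2 * δ < |(v i).im|)) (by simp)
  have hre' : #{σ : Finset ι | ‖b + ∑ i ∈ σ, v i‖ ≤ δ} ≤
      #{σ : Finset ι | |b.re + ∑ i ∈ σ, (v i).re| ≤ δ} := by
    refine Finset.card_le_card fun σ hσ => ?_
    simp only [Finset.mem_filter, Finset.mem_univ, true_and] at hσ ⊢
    simpa using (Complex.abs_re_le_norm _).trans hσ
  have him' : #{σ : Finset ι | ‖b + ∑ i ∈ σ, v i‖ ≤ δ} ≤
      #{σ : Finset ι | |b.im + ∑ i ∈ σ, (v i).im| ≤ δ} := by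
    refine Finset.card_le_card fun σ hσ => ?_
    simp only [Finset.mem_filter, Finset.mem_univ, true_and] at hσ ⊢
    simpa using (Complex.abs_im_le_norm _).trans hσ
  calc _ ≤ #{σ : Finset ι | ‖b + ∑ i ∈ σ, v i‖ ≤ δ} ^ 2 *
        (#(G.filter (fun i => 2 * δ < |(v i).re|)) + #(G.filter (fun i => 2 * δ < |(v i).im|))) := by
        gcongr
        exact (Finset.card_le_card hcover).trans (Finset.card_union_le _ _)
    _ ≤ 4 ^ Fintype.card ι + 4 ^ Fintype.card ι := by
        rw [mul_add]
        exact add_le_add ((Nat.mul_le_mul_right _ (Nat.pow_le_pow_left hre' 2)).trans hre)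
          ((Nat.mul_le_mul_right _ (Nat.pow_le_pow_left him' 2)).trans him)
    _ = 2 * 4 ^ Fintype.card ι := by ring

end PPoly

/-! ### Anti-concentration by symmetrization -/

namespace PPoly

open Finset in
/-- Chebyshev's bound for the number of successes in a product space. -/
theorem pi_real_card_le_half {ι E : Type*} [Fintype ι] [MeasurableSpace E] (ρ : Measure E)
    [IsProbabilityMeasure ρ] {A : Set E} [DecidablePred (· ∈ A)] (hA : MeasurableSet A) {p : ℝ}
    (hp : 0 < p) (hpA : p ≤ ρ.real A) {G : Finset ι} (hG : G.Nonempty) :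
    (Measure.pi fun _ : ι => ρ).real {q | (#{i ∈ G | q i ∈ A} : ℝ) ≤ p / 2 * #G} ≤
      1 / (p ^ 2 * #G) := by
  set π := Measure.pi fun _ : ι => ρ
  let Y : E → ℝ := A.indicator 1
  have hY : Measurable Y := measurable_one.indicator hA
  let X : ι → (ι → E) → ℝ := fun i q => Y (q i)
  have hX : ∀ i, Measurable (X i) := fun i => hY.comp (measurable_pi_apply i)
  have hY01 : ∀ e, Y e ∈ Set.Icc (0 : ℝ) 1 := fun e => by
    by_cases h : e ∈ A <;> simp [Y, h]
  have hL : ∀ i, MemLp (X i) 2 π := fun i =>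
    MemLp.of_bound (hX i).aestronglyMeasurable 1 (Eventually.of_forall fun q => by
      rw [Real.norm_of_nonneg (hY01 _).1]; exact (hY01 _).2)
  have hE : ∀ i, ∫ q, X i q ∂π = ρ.real A := by
    intro i
    have h : ∫ q, Y q ∂(π.map (Function.eval i)) = ∫ q, X i q ∂π :=
      integral_map (measurable_pi_apply i).aemeasurable hY.aestronglyMeasurable
    rw [← h, (measurePreserving_eval (fun _ : ι => ρ) i).map_eq]
    exact integral_indicator_one hA
  have hvar : ∀ i, variance (X i) π ≤ 1 / 4 := fun i => by
    have h := variance_le_sq_of_bounded (X := X i) (μ := π) (a := 0) (b := 1)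
      (Eventually.of_forall fun q => hY01 (q i)) (hX i).aemeasurable
    norm_num at h ⊢
    exact h
  have hV : variance (∑ i ∈ G, X i) π ≤ #G / 4 := by
    rw [IndepFun.variance_sum fun i _ => hL i]
    · calc ∑ i ∈ G, variance (X i) π ≤ ∑ i ∈ G, (1 / 4 : ℝ) := by
            refine Finset.sum_le_sum fun i _ => ?_
            exact hvar i
        _ = #G / 4 := by simp; ring
    · intro i _ j _ hij
      exact (iIndepFun_pi (μ := fun _ : ι => ρ) (X := fun _ : ι => Y)
        fun _ => hY.aemeasurable).indepFun hij
  have hsum : ∀ q, (∑ i ∈ G, X i) q = #{i ∈ G | q i ∈ A} := by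
    intro q
    simp [X, Y, Set.indicator_apply, Finset.sum_apply]
  have hEs : ∫ q, (∑ i ∈ G, X i) q ∂π = #G * ρ.real A := by
    simp_rw [Finset.sum_apply]
    rw [integral_finsetSum _ fun i _ => (hL i).integrable (by norm_num)]
    simp [hE]
  have hG0 : (0 : ℝ) < #G := by exact_mod_cast hG.card_pos
  -- The mean is at least `p * #G`, so at most half of that is a deviation of at least `p / 2 * #G`.
  have hcheb := meas_ge_le_variance_div_sq (memLp_finsetSum' G fun i _ => hL i)
    (c := p / 2 * #G) (by positivity)
  rw [hEs] at hcheb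
  calc π.real {q | (#{i ∈ G | q i ∈ A} : ℝ) ≤ p / 2 * #G}
      ≤ π.real {q | p / 2 * #G ≤ |(∑ i ∈ G, X i) q - #G * ρ.real A|} := by
        refine measureReal_mono fun q hq => ?_
        simp only [Set.mem_ofPred_eq] at hq ⊢
        rw [hsum, abs_sub_comm]
        refine le_trans ?_ (le_abs_self _)
        nlinarith
    _ ≤ variance (∑ i ∈ G, X i) π / (p / 2 * #G) ^ 2 :=
        ENNReal.toReal_le_of_le_ofReal (by have := variance_nonneg (∑ i ∈ G, X i) π; positivity) hcheb
    _ ≤ (#G / 4) / (p / 2 * #G) ^ 2 := by gcongr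
    _ = 1 / (p ^ 2 * #G) := by field_simp; norm_num

open Finset in
/-- An anti-concentration inequality of Kolmogorov–Rogozin type. -/
theorem pi_real_norm_sum_le {ι : Type*} [Fintype ι] (ν : Measure ℂ) [IsProbabilityMeasure ν]
    {p r : ℝ} (hp : 0 < p) (hpr : p ≤ (ν.prod ν).real {x | r ≤ ‖x.1 - x.2‖})
    (a : ι → ℂ) {δ : ℝ} {G : Finset ι} (hG : G.Nonempty)
    (ha : ∀ i ∈ G, 4 * δ < ‖a i‖ * r) :
    (Measure.pi fun _ : ι => ν).real {x | ‖∑ i, x i * a i‖ ≤ δ} ≤ 3 / (p ^ 2 * √(#G)) := by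
  classical
  set A : Set (ℂ × ℂ) := {x | r ≤ ‖x.1 - x.2‖} with hAdef
  have hA : MeasurableSet A := measurableSet_le (by fun_prop) (by fun_prop)
  set π := Measure.pi fun _ : ι => ν.prod ν with hπ
  set B : Set (ι → ℂ) := {x | ‖∑ i, x i * a i‖ ≤ δ} with hBdef
  have hB : MeasurableSet B := measurableSet_le (by fun_prop) (by fun_prop)
  set N := Fintype.card ι
  have hG0 : (0 : ℝ) < #G := by exact_mod_cast hG.card_pos
  -- Every selection `σ` of one entry per pair has the original product law, so the probability of
  -- `B` is the mean over all `2 ^ N` selections; it is estimated with the pairs frozen.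
  let T : Finset ι → (ι → ℂ × ℂ) → ι → ℂ := fun σ q i => if i ∈ σ then (q i).1 else (q i).2
  have hT : ∀ σ, MeasurePreserving (T σ) π (Measure.pi fun _ : ι => ν) := by
    intro σ
    refine measurePreserving_pi (fun _ => ν.prod ν) (fun _ => ν)
      (f := fun i (e : ℂ × ℂ) => if i ∈ σ then e.1 else e.2) fun i => ?_
    by_cases h : i ∈ σ
    · simpa [h] using measurePreserving_fst
    · simpa [h] using measurePreserving_snd
  let bad : Set (ι → ℂ × ℂ) := {q | (#{i ∈ G | q i ∈ A} : ℝ) ≤ p / 2 * #G}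
  have hbad : MeasurableSet bad := by
    have : bad = {q | (∑ i ∈ G, A.indicator (1 : ℂ × ℂ → ℝ) (q i)) ≤ p / 2 * #G} := by
      ext q; simp [bad, Set.indicator_apply]
    rw [this]
    refine measurableSet_le (Finset.measurable_sum _ fun i _ => ?_) measurable_const
    exact (measurable_one.indicator hA).comp (measurable_pi_apply i)
  -- Littlewood–Offord is applied with weights `((q i).1 - (q i).2) * a i`, which are large at the
  -- `i ∈ G` with `q i ∈ A`. When these are too few, the trivial count `2 ^ N` is used.
  have hcount : ∀ q, (∑ σ : Finset ι, (T σ ⁻¹' B).indicator (1 : (ι → ℂ × ℂ) → ℝ) q) ≤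
      2 ^ N * (2 / √(p * #G)) + bad.indicator (fun _ => (2 : ℝ) ^ N) q := by
    intro q
    have h1 : (∑ σ : Finset ι, (T σ ⁻¹' B).indicator (1 : (ι → ℂ × ℂ) → ℝ) q) =
        #{σ : Finset ι | T σ q ∈ B} := by
      simp [Set.indicator_apply]
    rw [h1]
    by_cases hq : q ∈ bad
    · rw [Set.indicator_of_mem hq]
      have h2 : (#{σ : Finset ι | T σ q ∈ B} : ℝ) ≤ 2 ^ N := by
        have := Finset.card_le_univ {σ : Finset ι | T σ q ∈ B}
        rw [Fintype.card_finset] at this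
        exact_mod_cast this
      have : (0 : ℝ) ≤ 2 ^ N * (2 / √(p * #G)) := by positivity
      linarith
    · rw [Set.indicator_of_notMem hq, add_zero]
      simp only [bad, Set.mem_ofPred_eq, not_le] at hq
      set m := #{i ∈ G | q i ∈ A}
      have hset : ∀ σ, T σ q ∈ B ↔
          ‖(∑ i, (q i).2 * a i) + ∑ i ∈ σ, ((q i).1 - (q i).2) * a i‖ ≤ δ := by
        intro σ
        have : ∑ i, T σ q i * a i =
            (∑ i, (q i).2 * a i) + ∑ i ∈ σ, ((q i).1 - (q i).2) * a i := by
          rw [← Finset.sum_ite_mem_eq σ, ← Finset.sum_add_distrib]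
          refine Finset.sum_congr rfl fun i _ => ?_
          by_cases h : i ∈ σ <;> simp [T, h, sub_mul]
        rw [hBdef, Set.mem_ofPred_eq, this]
      simp_rw [hset]
      have hLO := card_norm_add_sum_sq_mul_le (fun i => ((q i).1 - (q i).2) * a i)
        (∑ i, (q i).2 * a i) (δ := δ) {i ∈ G | q i ∈ A} (by
          intro i hi
          rw [Finset.mem_filter] at hi
          have h3 : r ≤ ‖(q i).1 - (q i).2‖ := hi.2
          rw [norm_mul, mul_comm ‖(q i).1 - (q i).2‖]
          exact (ha i hi.1).trans_le (by gcongr))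
      set k := #{σ : Finset ι | ‖(∑ i, (q i).2 * a i) + ∑ i ∈ σ, ((q i).1 - (q i).2) * a i‖ ≤ δ}
      have hLO' : (k : ℝ) ^ 2 * m ≤ 2 * 4 ^ N := by exact_mod_cast hLO
      rw [← mul_div_assoc, le_div_iff₀ (by positivity)]
      refine le_of_sq_le_sq ?_ (by positivity)
      rw [mul_pow, Real.sq_sqrt (by positivity)]
      have h4 : ((2 : ℝ) ^ N * 2) ^ 2 = 4 * 4 ^ N := by
        rw [mul_pow, ← pow_mul, mul_comm N, pow_mul]; norm_num; ring
      rw [h4]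
      nlinarith [mul_le_mul_of_nonneg_left hq.le (sq_nonneg (k : ℝ))]
  have hint : ∀ σ, Integrable ((T σ ⁻¹' B).indicator (1 : (ι → ℂ × ℂ) → ℝ)) π := fun σ =>
    (integrable_const 1).indicator ((hT σ).measurable hB)
  have hint' : Integrable (bad.indicator (fun _ => (2 : ℝ) ^ N)) π :=
    (integrable_const _).indicator hbad
  have hmain : 2 ^ N * (Measure.pi fun _ : ι => ν).real B ≤
      2 ^ N * (2 / √(p * #G)) + 2 ^ N * π.real bad := by
    calc 2 ^ N * (Measure.pi fun _ : ι => ν).real B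
        = ∑ σ : Finset ι, π.real (T σ ⁻¹' B) := by
          simp_rw [fun σ => (hT σ).measureReal_preimage hB.nullMeasurableSet]
          simp [N]
      _ = ∫ q, ∑ σ : Finset ι, (T σ ⁻¹' B).indicator (1 : (ι → ℂ × ℂ) → ℝ) q ∂π := by
          rw [integral_finsetSum _ fun σ _ => hint σ]
          simp_rw [fun σ => integral_indicator_one (μ := π) ((hT σ).measurable hB)]
      _ ≤ ∫ q, (2 ^ N * (2 / √(p * #G)) + bad.indicator (fun _ => (2 : ℝ) ^ N) q) ∂π :=
          integral_mono (integrable_finsetSum _ fun σ _ => hint σ)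
            ((integrable_const _).add hint') hcount
      _ = 2 ^ N * (2 / √(p * #G)) + 2 ^ N * π.real bad := by
          rw [integral_add (integrable_const _) hint', integral_indicator_const _ hbad]
          simp [mul_comm]
  rw [← mul_add] at hmain
  have h5 := le_of_mul_le_mul_left hmain (by positivity)
  have h6 : π.real bad ≤ 1 / (p ^ 2 * #G) := pi_real_card_le_half (ν.prod ν) hA hp hpr hG
  have hp1 : p ≤ 1 := hpr.trans measureReal_le_one
  have hs1 : 1 ≤ √(#G : ℝ) := by
    rw [Real.one_le_sqrt]; exact_mod_cast hG.card_pos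
  -- As `p ≤ 1 ≤ #G`, both error terms fit over one denominator, whence `3 = 2 + 1`.
  have h7 : p ^ 2 * √(#G) ≤ √(p * #G) := by
    rw [Real.sqrt_mul hp.le]
    gcongr
    refine (pow_le_of_le_one hp.le hp1 two_ne_zero).trans (Real.le_sqrt_of_sq_le ?_)
    exact pow_le_of_le_one hp.le hp1 two_ne_zero
  have h8 : p ^ 2 * √(#G) ≤ p ^ 2 * #G := by
    gcongr
    nlinarith [Real.sq_sqrt hG0.le]
  calc _ ≤ 2 / √(p * #G) + 1 / (p ^ 2 * #G) := h5.trans (by gcongr)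
    _ ≤ 2 / (p ^ 2 * √(#G)) + 1 / (p ^ 2 * √(#G)) := by gcongr
    _ = 3 / (p ^ 2 * √(#G)) := by ring

/-- A law that is not a point mass charges the pairs at some positive distance. -/
theorem exists_pos_prod_norm_sub (ν : Measure ℂ) [IsProbabilityMeasure ν]
    (h : ¬ ∃ w : ℂ, ∀ᵐ x ∂ν, x = w) :
    ∃ r > 0, 0 < (ν.prod ν).real {x | r ≤ ‖x.1 - x.2‖} := by
  by_contra! hcon
  have h1 : ∀ n : ℕ, ∀ᵐ x ∂(ν.prod ν), ‖x.1 - x.2‖ < 1 / ((n : ℝ) + 1) := by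
    intro n
    have h2 := (hcon (1 / ((n : ℝ) + 1)) (by positivity)).antisymm measureReal_nonneg
    rw [measureReal_eq_zero_iff] at h2
    rw [ae_iff]
    simpa only [not_lt] using h2
  have h3 : ∀ᵐ x ∂(ν.prod ν), x.2 = x.1 := by
    filter_upwards [ae_all_iff.2 h1] with x hx
    by_contra hne
    obtain ⟨n, hn⟩ := exists_nat_one_div_lt (norm_pos_iff.2 (sub_ne_zero.2 (Ne.symm hne)))
    exact lt_asymm hn (hx n)
  -- Fubini: freezing a typical first coordinate `w` makes the law a point mass at `w`.
  obtain ⟨w, hw⟩ := (Measure.ae_ae_of_ae_prod h3).exists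
  exact h ⟨w, hw⟩

end PPoly

/-! ### I.i.d. families: small balls, Borel–Cantelli, log-moments -/

namespace PPoly

open Finset in
/-- Anti-concentration of weighted sums of i.i.d. random variables. -/
theorem real_norm_sum_le_of_iIndepFun {κ Ω : Type*} [MeasurableSpace Ω] {μ : Measure Ω}
    [IsProbabilityMeasure μ] {ξ : κ → Ω → ℂ} {ν : Measure ℂ} [IsProbabilityMeasure ν]
    (hmeas : ∀ α, Measurable (ξ α)) (hindep : iIndepFun ξ μ) (hlaw : ∀ α, μ.map (ξ α) = ν)
    {p r : ℝ} (hp : 0 < p) (hpr : p ≤ (ν.prod ν).real {x | r ≤ ‖x.1 - x.2‖})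
    (a : κ → ℂ) {δ : ℝ} {s K : Finset κ} (hKs : K ⊆ s) (hK : K.Nonempty)
    (ha : ∀ α ∈ K, 4 * δ < ‖a α‖ * r) :
    μ.real {ω | ‖∑ α ∈ s, ξ α ω * a α‖ ≤ δ} ≤ 3 / (p ^ 2 * √(#K)) := by
  classical
  have hmap : μ.map (fun ω (i : s) => ξ i ω) = Measure.pi fun _ : s => ν := by
    have h := (iIndepFun_iff_map_fun_eq_pi_map (f := fun i : s => ξ i)
      fun i => (hmeas i).aemeasurable).1 (hindep.precomp Subtype.val_injective)
    rw [h]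
    simp_rw [hlaw]
  have hcard : #(K.subtype (· ∈ s)) = #K := by
    rw [Finset.card_subtype, Finset.filter_true_of_mem fun x hx => hKs hx]
  have hne : (K.subtype (· ∈ s)).Nonempty := by
    rw [← Finset.card_pos, hcard]
    exact hK.card_pos
  have h := pi_real_norm_sum_le ν hp hpr (fun i : s => a i) hne
    fun i hi => ha i (Finset.mem_subtype.1 hi)
  have hB : MeasurableSet {x : s → ℂ | ‖∑ i, x i * a i‖ ≤ δ} :=
    measurableSet_le (by fun_prop) (by fun_prop)
  rw [hcard, ← hmap, map_measureReal_apply (measurable_pi_lambda (fun ω (i : s) => ξ i ω) fun i => hmeas i) hB] at h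
  convert h using 3
  ext ω
  simp only [Set.mem_ofPred_eq, Set.mem_preimage]
  rw [← Finset.sum_coe_sort s]

theorem ae_eventually_notMem_of_summable {Ω : Type*} [MeasurableSpace Ω] {μ : Measure Ω}
    [IsFiniteMeasure μ] {s : ℕ → Set Ω} {u : ℕ → ℝ} (hu : Summable u)
    (h : ∀ᶠ n in atTop, μ.real (s n) ≤ u n) : ∀ᵐ ω ∂μ, ∀ᶠ n in atTop, ω ∉ s n := by
  obtain ⟨m, hm⟩ := eventually_atTop.1 h
  have hsum : ∑' n, μ (s (n + m)) ≠ ⊤ := by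
    refine ne_top_of_le_ne_top ((summable_nat_add_iff m).2 hu).tsum_ofReal_ne_top
      (ENNReal.tsum_le_tsum fun n => ?_)
    rw [← ofReal_measureReal]
    exact ENNReal.ofReal_le_ofReal (hm _ (Nat.le_add_left m n))
  filter_upwards [ae_eventually_notMem hsum] with ω hω
  obtain ⟨k, hk⟩ := eventually_atTop.1 hω
  refine eventually_atTop.2 ⟨k + m, fun n hn => ?_⟩
  have := hk (n - m) (by omega)
  rwa [Nat.sub_add_cancel (by omega)] at this

/-- Under a `d`-th logarithmic moment, only finitely many i.i.d. variables indexed by `ℕ^d` are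
exponentially large in the size of their index. -/
theorem ae_finite_setOf_mul_le_log {d : ℕ} {Ω : Type*} [MeasurableSpace Ω] {μ : Measure Ω}
    [IsProbabilityMeasure μ] {ξ : (Fin d → ℕ) → Ω → ℂ} (hmeas : ∀ α, Measurable (ξ α))
    (hident : ∀ α, IdentDistrib (ξ α) (ξ 0) μ μ)
    (hmoment : Integrable (fun ω => Real.log (1 + ‖ξ 0 ω‖) ^ d) μ) {ε : ℝ} (hε : 0 < ε) :
    ∀ᵐ ω ∂μ, {α : Fin d → ℕ | ∀ j, ε * α j ≤ Real.log (1 + ‖ξ α ω‖)}.Finite := by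
  set X : Ω → ℝ := fun ω => Real.log (1 + ‖ξ 0 ω‖) with hX
  have hXm : Measurable X := Real.measurable_log.comp ((hmeas 0).norm.const_add 1)
  have hX0 : ∀ ω, 0 ≤ X ω := fun ω => Real.log_nonneg (by simp)
  let B : (Fin d → ℕ) → Set Ω := fun α => {ω | ∀ j, ε * α j ≤ X ω}
  have hB : ∀ α, MeasurableSet (B α) := fun α => by
    simp only [B, Set.ofPred_forall]
    exact MeasurableSet.iInter fun j => measurableSet_le measurable_const hXm
  have hμ : ∀ α, μ {ω | ∀ j, ε * α j ≤ Real.log (1 + ‖ξ α ω‖)} = μ (B α) := fun α => by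
    refine (hident α).measure_mem_eq (s := {x : ℂ | ∀ j, ε * α j ≤ Real.log (1 + ‖x‖)}) ?_
    simp only [Set.ofPred_forall]
    exact MeasurableSet.iInter fun j => measurableSet_le measurable_const
      (Real.measurable_log.comp (measurable_norm.const_add 1))
  refine ae_finite_setOfPred_mem (s := fun α => {ω | ∀ j, ε * α j ≤ Real.log (1 + ‖ξ α ω‖)}) ?_
  simp_rw [hμ]
  -- Equal laws allow every event to be expressed through `ξ 0`. The sum of indicators then counts
  -- lattice points in a cube of side `X / ε`, a quantity of order `X ^ d`.
  have hbound : ∀ ω, ∑' α, (B α).indicator (1 : Ω → ENNReal) ω ≤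
      ENNReal.ofReal (2 ^ (d - 1) * ((1 / ε) ^ d * X ω ^ d + 1)) := by
    intro ω
    set m := ⌊X ω / ε⌋₊
    rw [tsum_eq_sum (s := Fintype.piFinset fun _ : Fin d => Finset.range (m + 1))]
    · calc ∑ α ∈ Fintype.piFinset fun _ : Fin d => Finset.range (m + 1),
            (B α).indicator (1 : Ω → ENNReal) ω
          ≤ ∑ α ∈ Fintype.piFinset fun _ : Fin d => Finset.range (m + 1), 1 :=
            Finset.sum_le_sum fun α _ => Set.indicator_le_self' (by simp) ω
        _ = ENNReal.ofReal ((m + 1 : ℝ) ^ d) := by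
            rw [Finset.sum_const, Fintype.card_piFinset_const, Finset.card_range, nsmul_one,
              ← ENNReal.ofReal_natCast]
            push_cast
            rfl
        _ ≤ _ := by
            refine ENNReal.ofReal_le_ofReal ?_
            have h1 : (m : ℝ) ≤ 1 / ε * X ω := by
              rw [one_div_mul_eq_div]
              exact Nat.floor_le (div_nonneg (hX0 ω) hε.le)
            calc (m + 1 : ℝ) ^ d ≤ (1 / ε * X ω + 1) ^ d := by gcongr
              _ ≤ 2 ^ (d - 1) * ((1 / ε * X ω) ^ d + 1 ^ d) :=
                  add_pow_le (mul_nonneg (by positivity) (hX0 ω)) zero_le_one d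
              _ = _ := by rw [mul_pow, one_pow]
    · intro α hα
      refine Set.indicator_of_notMem (fun hω => hα ?_) _
      refine Fintype.mem_piFinset.2 fun j => Finset.mem_range_succ_iff.2 (Nat.le_floor ?_)
      rw [le_div_iff₀ hε, mul_comm]
      exact hω j
  refine ne_top_of_le_ne_top (((hmoment.const_mul ((1 / ε) ^ d)).add
    (integrable_const 1)).const_mul (2 ^ (d - 1))).lintegral_lt_top.ne ?_
  calc ∑' α, μ (B α) = ∑' α, ∫⁻ ω, (B α).indicator (1 : Ω → ENNReal) ω ∂μ := by
        simp_rw [fun α => lintegral_indicator_one (μ := μ) (hB α)]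
    _ = ∫⁻ ω, ∑' α, (B α).indicator (1 : Ω → ENNReal) ω ∂μ :=
        (lintegral_tsum fun α => (measurable_one.indicator (hB α)).aemeasurable).symm
    _ ≤ ∫⁻ ω, ENNReal.ofReal (2 ^ (d - 1) * ((1 / ε) ^ d * X ω ^ d + 1)) ∂μ :=
        lintegral_mono hbound

/-- The finitely many exceptional indices at rate `η / R` are absorbed by large `n`; any other index
has a coordinate with `log(1 + |ξ_α|) < (η / R) α_j ≤ η n`. -/
theorem ae_eventually_log_norm_le {d : ℕ} {Ω : Type*} [MeasurableSpace Ω] {μ : Measure Ω}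
    [IsProbabilityMeasure μ] {ξ : (Fin d → ℕ) → Ω → ℂ} (hmeas : ∀ α, Measurable (ξ α))
    (hident : ∀ α, IdentDistrib (ξ α) (ξ 0) μ μ)
    (hmoment : Integrable (fun ω => Real.log (1 + ‖ξ 0 ω‖) ^ d) μ) {R η : ℝ} (hR : 0 < R)
    (hη : 0 < η) :
    ∀ᵐ ω ∂μ, ∀ᶠ n : ℕ in atTop, ∀ α : Fin d → ℕ, (∀ j, (α j : ℝ) ≤ R * n) →
      Real.log (1 + ‖ξ α ω‖) ≤ η * n := by
  filter_upwards [ae_finite_setOf_mul_le_log hmeas hident hmoment (div_pos hη hR)] with ω hω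
  have h1 : ∀ᶠ n : ℕ in atTop, ∀ α ∈ {α : Fin d → ℕ | ∀ j, η / R * α j ≤
      Real.log (1 + ‖ξ α ω‖)}, Real.log (1 + ‖ξ α ω‖) ≤ η * n := by
    refine (eventually_all_finite hω).2 fun α _ => ?_
    exact (tendsto_natCast_atTop_atTop.const_mul_atTop hη).eventually_ge_atTop _
  filter_upwards [h1] with n hn α hα
  by_cases h : α ∈ {α : Fin d → ℕ | ∀ j, η / R * α j ≤ Real.log (1 + ‖ξ α ω‖)}
  · exact hn α h
  · simp only [Set.mem_ofPred_eq, not_forall, not_le] at h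
    obtain ⟨j, hj⟩ := h
    calc Real.log (1 + ‖ξ α ω‖) ≤ η / R * α j := hj.le
      _ ≤ η / R * (R * n) := by gcongr; exact hα j
      _ = η * n := by field_simp

end PPoly

/-! ### Lattice points, weights and the potential -/

namespace PPoly

theorem div_mem_of_mem_latticeSet {d : ℕ} {P : Set (Fin d → ℝ)} {n : ℕ} (hn : n ≠ 0)
    {α : Fin d → ℕ} (hα : α ∈ latticeSet P n) : (fun j => (α j : ℝ) / n) ∈ P := by
  obtain ⟨t, ht, h⟩ := hα
  convert ht using 2 with j
  have := congrFun h j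
  simp only [Pi.smul_apply, smul_eq_mul] at this
  rw [← this]
  field_simp

theorem mem_latticeSet_of_div_mem {d : ℕ} {P : Set (Fin d → ℝ)} {n : ℕ} (hn : n ≠ 0)
    {α : Fin d → ℕ} (hα : (fun j => (α j : ℝ) / n) ∈ P) : α ∈ latticeSet P n := by
  refine ⟨_, hα, funext fun j => ?_⟩
  simp only [Pi.smul_apply, smul_eq_mul]
  field_simp

theorem continuousOn_legendre_integrand {d : ℕ} {P : Set (Fin d → ℝ)} {f : (Fin d → ℝ) → ℝ}
    (hfcont : ContinuousOn f P) (hfpos : ∀ t ∈ P, 0 < f t) (s : Fin d → ℝ) :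
    ContinuousOn (fun t : Fin d → ℝ => (∑ j, s j * t j) + Real.log (f t)) P :=
  (Continuous.continuousOn (by fun_prop)).add (hfcont.log fun t ht => (hfpos t ht).ne')

theorem le_legendre {d : ℕ} {P : Set (Fin d → ℝ)} (hP : IsCompact P) {f : (Fin d → ℝ) → ℝ}
    (hfcont : ContinuousOn f P) (hfpos : ∀ t ∈ P, 0 < f t) (s : Fin d → ℝ) {t : Fin d → ℝ}
    (ht : t ∈ P) : (∑ j, s j * t j) + Real.log (f t) ≤ legendre P f s :=
  le_csSup (hP.image_of_continuousOn (continuousOn_legendre_integrand hfcont hfpos s)).bddAbove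
    (Set.mem_image_of_mem _ ht)

/-- A convex body contains a box on which the integrand is nearly maximal. -/
theorem exists_box_lt {d : ℕ} {P : Set (Fin d → ℝ)} (hconvex : Convex ℝ P)
    (hint : (interior P).Nonempty) {f : (Fin d → ℝ) → ℝ} (hfcont : ContinuousOn f P)
    (hfpos : ∀ t ∈ P, 0 < f t) (s : Fin d → ℝ) {b : ℝ} (hb : b < legendre P f s) :
    ∃ t₀ ∈ P, ∃ ρ > 0, ∀ t : Fin d → ℝ, (∀ j, t₀ j ≤ t j ∧ t j ≤ t₀ j + ρ) →
      t ∈ P ∧ b < (∑ j, s j * t j) + Real.log (f t) := by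
  obtain ⟨-, ⟨t₁, ht₁, rfl⟩, hlt⟩ := exists_lt_of_lt_csSup
    ((hint.mono interior_subset).image _) hb
  obtain ⟨U, hU, ht₁U, hUP⟩ := mem_nhdsWithin.1
    ((continuousOn_legendre_integrand hfcont hfpos s t₁ ht₁).eventually_const_lt hlt)
  -- The near-maximal point may lie on the boundary, but a convex body lies in the closure of its
  -- interior, so an interior point nearby serves as well.
  have hcl : t₁ ∈ closure (interior P) := by
    rw [hconvex.closure_interior_eq_closure_of_nonempty_interior hint]
    exact subset_closure ht₁
  obtain ⟨t₀, ht₀U, ht₀P⟩ := mem_closure_iff.1 hcl U hU ht₁U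
  obtain ⟨ρ, hρ, hball⟩ := Metric.isOpen_iff.1 (hU.inter isOpen_interior) t₀ ⟨ht₀U, ht₀P⟩
  refine ⟨t₀, interior_subset ht₀P, ρ / 2, by positivity, fun t ht => ?_⟩
  have htb : t ∈ Metric.ball t₀ ρ := by
    rw [Metric.mem_ball, dist_pi_lt_iff hρ]
    intro j
    rw [Real.dist_eq, abs_lt]
    constructor <;> linarith [(ht j).1, (ht j).2]
  obtain ⟨h1, h2⟩ := hball htb
  exact ⟨interior_subset h2, hUP ⟨h1, interior_subset h2⟩⟩

/-- Scaled boxes contain many lattice points. -/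
theorem exists_finset_card_eq_floor_pow {d : ℕ} {t₀ : Fin d → ℝ} (ht₀ : ∀ j, 0 ≤ t₀ j) {ρ : ℝ}
    (hρ : 0 < ρ) {n : ℕ} (hn : n ≠ 0) :
    ∃ K : Finset (Fin d → ℕ), K.card = ⌊n * ρ⌋₊ ^ d ∧
      ∀ α ∈ K, ∀ j, t₀ j ≤ (α j : ℝ) / n ∧ (α j : ℝ) / n ≤ t₀ j + ρ := by
  -- The last integer of each `Ico` is one below its right end, which compensates for the ceiling at
  -- the left end.
  refine ⟨Fintype.piFinset fun j => Finset.Ico ⌈n * t₀ j⌉₊ (⌈n * t₀ j⌉₊ + ⌊n * ρ⌋₊), ?_, ?_⟩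
  · simp
  · intro α hα j
    have hn0 : (0 : ℝ) < n := by positivity
    obtain ⟨h1, h2⟩ := Finset.mem_Ico.1 (Fintype.mem_piFinset.1 hα j)
    have h3 : n * t₀ j ≤ α j := Nat.ceil_le.1 h1
    have h4 : (α j : ℝ) + 1 ≤ ⌈n * t₀ j⌉₊ + ⌊n * ρ⌋₊ := by exact_mod_cast h2
    have h5 := Nat.ceil_lt_add_one (mul_nonneg hn0.le (ht₀ j))
    have h6 := Nat.floor_le (mul_nonneg hn0.le hρ.le)
    refine ⟨(le_div_iff₀ hn0).2 (by linarith), (div_le_iff₀ hn0).2 (by linarith)⟩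

/-- The deterministic part `c_{α,n} z^α` of the terms of the random polynomial. -/
noncomputable def weight {d : ℕ} (c : (Fin d → ℕ) → ℕ → ℂ) (z : Fin d → ℂ) (n : ℕ)
    (α : Fin d → ℕ) : ℂ :=
  c α n * ∏ j, z j ^ α j

theorem randPoly_eq_sum {d : ℕ} {Ω : Type*} {P : Set (Fin d → ℝ)} (hP : Bornology.IsBounded P)
    (ξ : (Fin d → ℕ) → Ω → ℂ) (c : (Fin d → ℕ) → ℕ → ℂ) (n : ℕ) (z : Fin d → ℂ) (ω : Ω) :
    randPoly P ξ c n z ω = ∑ α ∈ (latticeSet_finite hP n).toFinset, ξ α ω * weight c z n α := by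
  rw [randPoly, finsum_mem_eq_finite_toFinset_sum _ (latticeSet_finite hP n)]
  simp_rw [weight, mul_assoc]

/-- The size of the weights is governed by the integrand of the potential. -/
theorem HasProfile.eventually_weight {d : ℕ} {P : Set (Fin d → ℝ)} {f : (Fin d → ℝ) → ℝ}
    {c : (Fin d → ℕ) → ℕ → ℂ} (h : HasProfile P f c) {z : Fin d → ℂ} (hz : ∀ j, z j ≠ 0) {ε : ℝ}
    (hε : 0 < ε) :
    ∀ᶠ n : ℕ in atTop, ∀ α ∈ latticeSet P n, weight c z n α ≠ 0 ∧
      |Real.log ‖weight c z n α‖ - n * ((∑ j, Real.log ‖z j‖ * ((α j : ℝ) / n)) +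
        Real.log (f fun j => (α j : ℝ) / n))| ≤ ε * n := by
  filter_upwards [h ε hε, eventually_ne_atTop 0] with n hn hn0 α hα
  obtain ⟨hc, hle⟩ := hn α hα
  have hprod : ∏ j, z j ^ α j ≠ 0 := Finset.prod_ne_zero_iff.2 fun j _ => pow_ne_zero _ (hz j)
  refine ⟨mul_ne_zero hc hprod, ?_⟩
  have hlog : Real.log ‖weight c z n α‖ =
      Real.log ‖c α n‖ + ∑ j, (α j : ℝ) * Real.log ‖z j‖ := by
    rw [weight, norm_mul, Real.log_mul (norm_ne_zero_iff.2 hc) (norm_ne_zero_iff.2 hprod),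
      norm_prod, Real.log_prod fun j _ => norm_ne_zero_iff.2 (pow_ne_zero _ (hz j))]
    simp
  have hn1 : (0 : ℝ) < n := by positivity
  have hsum : n * ∑ j, Real.log ‖z j‖ * ((α j : ℝ) / n) = ∑ j, (α j : ℝ) * Real.log ‖z j‖ := by
    rw [Finset.mul_sum]
    refine Finset.sum_congr rfl fun j _ => ?_
    field_simp
  have heq : Real.log ‖weight c z n α‖ - n * ((∑ j, Real.log ‖z j‖ * ((α j : ℝ) / n)) +
        Real.log (f fun j => (α j : ℝ) / n)) =
      ((1 / (n : ℝ)) * Real.log ‖c α n‖ - Real.log (f fun j => (α j : ℝ) / n)) * n := by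
    rw [hlog, mul_add, hsum]
    field_simp
    ring
  rw [heq, abs_mul, abs_of_pos hn1]
  gcongr

theorem card_latticeSet_le {d : ℕ} {P : Set (Fin d → ℝ)} (hP : Bornology.IsBounded P) {R : ℕ}
    (hR : ∀ t ∈ P, ∀ j, t j ≤ R) (n : ℕ) :
    (latticeSet_finite hP n).toFinset.card ≤ (R * n + 1) ^ d := by
  calc (latticeSet_finite hP n).toFinset.card
      ≤ (Fintype.piFinset fun _ : Fin d => Finset.range (R * n + 1)).card := by
        refine Finset.card_le_card fun α hα => ?_
        obtain ⟨t, ht, h⟩ := (Set.Finite.mem_toFinset _).1 hα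
        refine Fintype.mem_piFinset.2 fun j => Finset.mem_range_succ_iff.2 ?_
        have h1 : n * t j = α j := congrFun h j
        have h2 : (α j : ℝ) ≤ R * n := by
          rw [← h1, mul_comm]
          exact mul_le_mul_of_nonneg_right (hR t ht j) (Nat.cast_nonneg n)
        exact_mod_cast h2
    _ = (R * n + 1) ^ d := by simp

theorem eventually_pow_le_exp (R d : ℕ) {ε : ℝ} (hε : 0 < ε) :
    ∀ᶠ n : ℕ in atTop, ((R * n + 1 : ℕ) : ℝ) ^ d ≤ Real.exp (n * ε) := by
  have h1 := (tendsto_pow_const_div_const_pow_of_one_lt d (Real.one_lt_exp_iff.2 hε)).const_mul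
    (((R : ℝ) + 1) ^ d)
  rw [mul_zero] at h1
  filter_upwards [h1.eventually_le_const one_pos, eventually_ge_atTop 1] with n hn hn1
  have hn1' : (1 : ℝ) ≤ n := by exact_mod_cast hn1
  rw [Real.exp_nat_mul]
  rw [← mul_div_assoc, div_le_one (by positivity), ← mul_pow] at hn
  refine le_trans ?_ hn
  push_cast
  gcongr
  linarith

/-! ### The two almost sure exponential bounds -/

theorem ae_eventually_norm_randPoly_le {d : ℕ} {Ω : Type*} [MeasurableSpace Ω] {μ : Measure Ω}
    [IsProbabilityMeasure μ] {ξ : (Fin d → ℕ) → Ω → ℂ} (hmeas : ∀ α, Measurable (ξ α))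
    (hident : ∀ α, IdentDistrib (ξ α) (ξ 0) μ μ)
    (hmoment : Integrable (fun ω => Real.log (1 + ‖ξ 0 ω‖) ^ d) μ)
    {P : Set (Fin d → ℝ)} (hcompact : IsCompact P)
    {f : (Fin d → ℝ) → ℝ} (hfcont : ContinuousOn f P) (hfpos : ∀ t ∈ P, 0 < f t)
    {c : (Fin d → ℕ) → ℕ → ℂ} (hprofile : HasProfile P f c)
    {z : Fin d → ℂ} (hz : ∀ j, z j ≠ 0) {η : ℝ} (hη : 0 < η) :
    ∀ᵐ ω ∂μ, ∀ᶠ n : ℕ in atTop,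
      ‖randPoly P ξ c n z ω‖ ≤ Real.exp (n * (potential P f z + η)) := by
  obtain ⟨R₀, hR₀⟩ := hcompact.isBounded.exists_norm_le
  obtain ⟨R, hR⟩ := exists_nat_ge (max R₀ 1)
  have hRP : ∀ t ∈ P, ∀ j, t j ≤ R := fun t ht j =>
    (le_abs_self _).trans ((norm_le_pi_norm t j).trans
      ((hR₀ t ht).trans ((le_max_left _ _).trans hR)))
  have hRpos : (0 : ℝ) < R := one_pos.trans_le ((le_max_right _ _).trans hR)
  -- One third of `η` each for the coefficients, the weights and the number of terms.
  filter_upwards [ae_eventually_log_norm_le hmeas hident hmoment hRpos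
    (show 0 < η / 3 by positivity)] with ω hω
  filter_upwards [hω, hprofile.eventually_weight hz (show 0 < η / 3 by positivity),
    eventually_pow_le_exp R d (show 0 < η / 3 by positivity), eventually_ne_atTop 0]
    with n hξ hw hexp hn0
  have hterm : ∀ α ∈ (latticeSet_finite hcompact.isBounded n).toFinset,
      ‖ξ α ω * weight c z n α‖ ≤ Real.exp (n * (potential P f z + 2 * (η / 3))) := by
    intro α hα
    rw [Set.Finite.mem_toFinset] at hα
    have hP := div_mem_of_mem_latticeSet hn0 hα
    have h1 : ‖ξ α ω‖ ≤ Real.exp (η / 3 * n) := by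
      have h2 := hξ α fun j => (div_le_iff₀ (by positivity)).1 (hRP _ hP j)
      rw [Real.log_le_iff_le_exp (by positivity)] at h2
      linarith
    obtain ⟨hw0, hle⟩ := hw α hα
    have h3 : ‖weight c z n α‖ ≤ Real.exp (n * (potential P f z + η / 3)) := by
      rw [← Real.log_le_iff_le_exp (norm_pos_iff.2 hw0)]
      have h4 := le_legendre hcompact hfcont hfpos (fun j => Real.log ‖z j‖) hP
      have h5 := mul_le_mul_of_nonneg_left h4 (Nat.cast_nonneg (α := ℝ) n)
      rw [potential]
      linarith [(abs_le.1 hle).2]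
    calc ‖ξ α ω * weight c z n α‖ = ‖ξ α ω‖ * ‖weight c z n α‖ := norm_mul _ _
      _ ≤ Real.exp (η / 3 * n) * Real.exp (n * (potential P f z + η / 3)) := by gcongr
      _ = _ := by rw [← Real.exp_add]; ring_nf
  rw [randPoly_eq_sum hcompact.isBounded]
  calc _ ≤ ∑ α ∈ (latticeSet_finite hcompact.isBounded n).toFinset,
        Real.exp (n * (potential P f z + 2 * (η / 3))) := norm_sum_le_of_le _ hterm
    _ = (latticeSet_finite hcompact.isBounded n).toFinset.card *
        Real.exp (n * (potential P f z + 2 * (η / 3))) := by rw [Finset.sum_const, nsmul_eq_mul]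
    _ ≤ Real.exp (n * (η / 3)) * Real.exp (n * (potential P f z + 2 * (η / 3))) := by
        gcongr
        refine le_trans ?_ hexp
        exact_mod_cast card_latticeSet_le hcompact.isBounded hRP n
    _ = Real.exp (n * (potential P f z + η)) := by rw [← Real.exp_add]; ring_nf

theorem ae_eventually_lt_norm_randPoly {d : ℕ} (hd : 2 < d) {Ω : Type*} [MeasurableSpace Ω]
    {μ : Measure Ω} [IsProbabilityMeasure μ] {ξ : (Fin d → ℕ) → Ω → ℂ}
    (hmeas : ∀ α, Measurable (ξ α)) (hindep : iIndepFun ξ μ)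
    (hident : ∀ α, IdentDistrib (ξ α) (ξ 0) μ μ) (hnondeg : ¬ ∃ w : ℂ, ∀ᵐ ω ∂μ, ξ 0 ω = w)
    {P : Set (Fin d → ℝ)} (hcompact : IsCompact P) (hconvex : Convex ℝ P)
    (hint : (interior P).Nonempty) (horthant : ∀ t ∈ P, ∀ j, 0 ≤ t j)
    {f : (Fin d → ℝ) → ℝ} (hfcont : ContinuousOn f P) (hfpos : ∀ t ∈ P, 0 < f t)
    {c : (Fin d → ℕ) → ℕ → ℂ} (hprofile : HasProfile P f c)
    {z : Fin d → ℂ} (hz : ∀ j, z j ≠ 0) {η : ℝ} (hη : 0 < η) :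
    ∀ᵐ ω ∂μ, ∀ᶠ n : ℕ in atTop,
      Real.exp (n * (potential P f z - η)) < ‖randPoly P ξ c n z ω‖ := by
  set ν := μ.map (ξ 0) with hν
  have : IsProbabilityMeasure ν := Measure.isProbabilityMeasure_map (hmeas 0).aemeasurable
  obtain ⟨r, hr, hp⟩ := exists_pos_prod_norm_sub ν fun ⟨w, hw⟩ =>
    hnondeg ⟨w, ae_of_ae_map (hmeas 0).aemeasurable hw⟩
  set p := (ν.prod ν).real {x | r ≤ ‖x.1 - x.2‖}
  -- The box and the profile cost `η / 4` each, so weights on the box are at least `exp(n(Φ -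
  -- η/2))`; the remaining `exp(-ηn/2)` beats the factor `4 / r`.
  obtain ⟨t₀, ht₀, ρ, hρ, hbox⟩ := exists_box_lt hconvex hint hfcont hfpos
    (fun j => Real.log ‖z j‖) (b := potential P f z - η / 4) (by rw [potential]; linarith)
  -- Since `d ≥ 3`, the box has at least `(ρn/2)^3` lattice points for large `n`, and the square
  -- root gives the summable power `3/2`.
  have hsummable : Summable fun n : ℕ => 3 / (p ^ 2 * √((ρ / 2) ^ 3)) * (1 / (n : ℝ) ^ (3 / 2 : ℝ)) :=
    (Real.summable_one_div_nat_rpow.2 (by norm_num)).mul_left _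
  have hsmall : ∀ᶠ n : ℕ in atTop, 4 * Real.exp (-(η / 2 * n)) < r := by
    have h1 : Tendsto (fun n : ℕ => 4 * Real.exp (-(η / 2 * n))) atTop (𝓝 (4 * 0)) :=
      (Real.tendsto_exp_neg_atTop_nhds_zero.comp
        (tendsto_natCast_atTop_atTop.const_mul_atTop (by positivity))).const_mul 4
    rw [mul_zero] at h1
    exact h1.eventually_lt_const hr
  -- Then `⌊nρ⌋ > nρ - 1 ≥ nρ/2`.
  have hlarge : ∀ᶠ n : ℕ in atTop, 2 ≤ ρ * n :=
    (tendsto_natCast_atTop_atTop.const_mul_atTop hρ).eventually_ge_atTop 2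
  have hbound : ∀ᶠ n : ℕ in atTop,
      μ.real {ω | ‖randPoly P ξ c n z ω‖ ≤ Real.exp (n * (potential P f z - η))} ≤
        3 / (p ^ 2 * √((ρ / 2) ^ 3)) * (1 / (n : ℝ) ^ (3 / 2 : ℝ)) := by
    filter_upwards [hprofile.eventually_weight hz (show 0 < η / 4 by positivity), hsmall, hlarge,
      eventually_ne_atTop 0] with n hw hsm hlg hn0
    have hn1 : (0 : ℝ) < n := by positivity
    obtain ⟨K, hKcard, hK⟩ := exists_finset_card_eq_floor_pow (horthant t₀ ht₀) hρ hn0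
    have hKP : ∀ α ∈ K, α ∈ latticeSet P n := fun α hα =>
      mem_latticeSet_of_div_mem hn0 (hbox _ (hK α hα)).1
    have hfl : ρ / 2 * n ≤ ⌊n * ρ⌋₊ := by
      have := Nat.lt_floor_add_one (n * ρ)
      linarith
    have hfl1 : (1 : ℝ) ≤ ⌊n * ρ⌋₊ := le_trans (by linarith) hfl
    have hKpos : 0 < K.card := by
      rw [hKcard]
      exact pow_pos (by exact_mod_cast hfl1) d
    have hKge : (ρ / 2) ^ 3 * (n : ℝ) ^ 3 ≤ K.card := by
      rw [hKcard, ← mul_pow]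
      push_cast
      calc (ρ / 2 * n) ^ 3 ≤ (⌊n * ρ⌋₊ : ℝ) ^ 3 := by gcongr
        _ ≤ (⌊n * ρ⌋₊ : ℝ) ^ d := pow_le_pow_right₀ hfl1 hd
    have hlow : ∀ α ∈ K, 4 * Real.exp (n * (potential P f z - η)) < ‖weight c z n α‖ * r := by
      intro α hα
      obtain ⟨hw0, hle⟩ := hw α (hKP α hα)
      have h1 := mul_le_mul_of_nonneg_left (hbox _ (hK α hα)).2.le hn1.le
      have h2 : Real.exp (n * (potential P f z - η / 2)) ≤ ‖weight c z n α‖ := by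
        rw [← Real.le_log_iff_exp_le (norm_pos_iff.2 hw0)]
        linarith [(abs_le.1 hle).1]
      calc 4 * Real.exp (n * (potential P f z - η))
          = Real.exp (n * (potential P f z - η / 2)) * (4 * Real.exp (-(η / 2 * n))) := by
            rw [mul_left_comm, ← Real.exp_add]; ring_nf
        _ < Real.exp (n * (potential P f z - η / 2)) * r := by gcongr
        _ ≤ ‖weight c z n α‖ * r := by gcongr
    simp_rw [randPoly_eq_sum hcompact.isBounded]
    calc _ ≤ 3 / (p ^ 2 * √K.card) :=
          real_norm_sum_le_of_iIndepFun hmeas hindep (fun α => (hident α).map_eq) hp le_rfl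
            (weight c z n) (fun α hα => (Set.Finite.mem_toFinset _).2 (hKP α hα))
            (Finset.card_pos.1 hKpos) hlow
      _ ≤ 3 / (p ^ 2 * √((ρ / 2) ^ 3 * (n : ℝ) ^ 3)) := by gcongr
      _ = 3 / (p ^ 2 * √((ρ / 2) ^ 3)) * (1 / (n : ℝ) ^ (3 / 2 : ℝ)) := by
          have h1 : √((n : ℝ) ^ 3) = (n : ℝ) ^ (3 / 2 : ℝ) := by
            rw [Real.sqrt_eq_rpow, ← Real.rpow_natCast, ← Real.rpow_mul hn1.le]
            norm_num
          rw [Real.sqrt_mul (by positivity), h1]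
          field_simp
  filter_upwards [ae_eventually_notMem_of_summable hsummable hbound] with ω hω
  filter_upwards [hω] with n hn
  simpa using hn

end PPoly

theorem theorem4p4 {d : ℕ} (hd : 2 < d)
    {Ω : Type*} [MeasurableSpace Ω] (μ : Measure Ω) [IsProbabilityMeasure μ]
    -- i.i.d. complex coefficients, not almost surely constant, with the log-moment condition
    (ξ : (Fin d → ℕ) → Ω → ℂ)
    (hmeas : ∀ α, Measurable (ξ α))
    (hindep : iIndepFun ξ μ)
    (hident : ∀ α, IdentDistrib (ξ α) (ξ 0) μ μ)
    (hnondeg : ¬ ∃ w : ℂ, ∀ᵐ ω ∂μ, ξ 0 ω = w)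
    (hmoment : Integrable (fun ω => Real.log (1 + ‖ξ 0 ω‖) ^ d) μ)
    -- a convex body in the closed orthant, containing the origin
    (P : Set (Fin d → ℝ)) (hcompact : IsCompact P) (hconvex : Convex ℝ P)
    (hint : (interior P).Nonempty) (hzero : (0 : Fin d → ℝ) ∈ P)
    (horthant : ∀ t ∈ P, ∀ j, 0 ≤ t j)
    -- a continuous positive profile on it, and a coefficient array with this profile
    (f : (Fin d → ℝ) → ℝ) (hfcont : ContinuousOn f P) (hfpos : ∀ t ∈ P, 0 < f t)
    (c : (Fin d → ℕ) → ℕ → ℂ) (hprofile : PPoly.HasProfile P f c)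
    -- a point of the complex torus
    (z : Fin d → ℂ) (hz : ∀ j, z j ≠ 0) :
    ∀ᵐ ω ∂μ,
      (∀ᶠ n : ℕ in atTop, PPoly.randPoly P ξ c n z ω ≠ 0) ∧
        Tendsto (fun n : ℕ => (1 / (n : ℝ)) * Real.log ‖PPoly.randPoly P ξ c n z ω‖) atTop
          (𝓝 (PPoly.potential P f z)) := by
  -- The errors `1 / (k + 1)` form a countable family, so one null set serves for all of them.
  have hpos : ∀ k : ℕ, (0 : ℝ) < 1 / ((k : ℝ) + 1) := fun k => Nat.one_div_pos_of_nat
  have hupper := ae_all_iff.2 fun k : ℕ => PPoly.ae_eventually_norm_randPoly_le hmeas hident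
    hmoment hcompact hfcont hfpos hprofile hz (hpos k)
  have hlower := ae_all_iff.2 fun k : ℕ => PPoly.ae_eventually_lt_norm_randPoly hd hmeas hindep
    hident hnondeg hcompact hconvex hint horthant hfcont hfpos hprofile hz (hpos k)
  filter_upwards [hupper, hlower] with ω hu hl
  have hne : ∀ᶠ n : ℕ in atTop, PPoly.randPoly P ξ c n z ω ≠ 0 := by
    filter_upwards [hl 0] with n hn
    exact norm_pos_iff.1 ((Real.exp_pos _).trans hn)
  refine ⟨hne, Metric.tendsto_nhds.2 fun ε hε => ?_⟩
  obtain ⟨k, hk⟩ := exists_nat_one_div_lt hε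
  filter_upwards [hne, hu k, hl k, eventually_gt_atTop 0] with n hn0 hun hln hn
  have hn' : (0 : ℝ) < n := by exact_mod_cast hn
  have hnorm := norm_pos_iff.2 hn0
  rw [← Real.log_le_iff_le_exp hnorm, mul_comm, ← div_le_iff₀ hn'] at hun
  rw [← Real.lt_log_iff_exp_lt hnorm, mul_comm, ← lt_div_iff₀ hn'] at hln
  rw [Real.dist_eq, one_div_mul_eq_div, abs_lt]
  constructor <;> linarith
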